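/- Let $\mathbf S^n$ be the space of real symmetric $n\times n$ matrices with the inner product $\langle X,Y\rangle=\operatorname{tr}(XY)$, and for $X\in\mathbf S^n$ let $\lambda(X)=(\lambda_1(X),\dots,\lambda_n(X))\in\mathbb R^n$ be the vector of its eigenvalues (with multiplicity) in nonincreasing order, and $\Lambda(X)=\operatorname{Diag}(\lambda(X))$. Let $\mathbf O^n(X)$ be the set of orthogonal matrices $U$ with $X=U\Lambda(X)U^\top$. For an extended-real-valued function $f$ on a Euclidean space, a point $x$ at which $f$ is finite, and vectors $v,w$, the second subderivative is $$\mathrm d^2f(x,v)(w)=\liminf_{t\downarrow 0,\ w'\to w}\frac{f(x+tw')-f(x)-t\langle v,w'\rangle}{\frac12t^2}\in[-\infty,\infty].$$ Let $g:\mathbf S^n\to[-\infty,\infty]$ be of the form $g=\theta\circ\lambda$, where $\theta:\mathbb R^n\to[-\infty,\infty]$ is invariant under permutations of the coordinates, and assume that $g$ is lower semicontinuous and convex. Let $X\in\mathbf S^n$ with $g(X)$ finite and let $Y\in\partial g(X)$ (the subdifferential of convex analysis). Let $\mu_1>\dots>\mu_r$ be the distinct eigenvalues of $X$, let $\alpha_m=\{i\mid\lambda_i(X)=\mu_m\}$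 for $m=1,\dots,r$, and let $U\in\mathbf O^n(X)\cap\mathbf O^n(Y)$. Then for every $H\in\mathbf S^n$ the directional derivative $\lambda'(X;H)=\lim_{t\downarrow0}\big(\lambda(X+tH)-\lambda(X)\big)/t$ exists and $$\mathrm d^2g(X,Y)(H)\ \ge\ \mathrm d^2\theta\big(\lambda(X),\lambda(Y)\big)\big(\lambda'(X;H)\big)+2\sum_{m=1}^r\Big\langle \Lambda(Y)_{\alpha_m\alpha_m},\,U_{\alpha_m}^\top H(\mu_mI-X)^\dagger HU_{\alpha_m}\Big\rangle .$$ Here $U_{\alpha_m}$ is the submatrix of $U$ consisting of the columns indexed by $\alpha_m$, $\Lambda(Y)_{\alpha_m\alpha_m}$ is the principal submatrix of $\Lambda(Y)$ on $\alpha_m$, and $Z^\dagger$ is the Moore–Penrose inverse of $Z$. -/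

import Mathlib

open Filter Topology

noncomputable section

namespace SpectralFun

/-! ### Symmetric matrices with the trace inner product -/

/-- The real vector space of symmetric `n × n` real matrices. -/
def symSubmodule (n : ℕ) : Submodule ℝ (Matrix (Fin n) (Fin n) ℝ) where
  carrier := {A | A.IsSymm}
  add_mem' hA hB := hA.add hB
  zero_mem' := Matrix.isSymm_zero
  smul_mem' c _ hA := hA.smul c

/-- `𝐒ⁿ`. Its topology is the one it inherits from the space of matrices; on this
finite-dimensional space it is the topology of the Frobenius norm. -/
abbrev SymMat (n : ℕ) : Type := symSubmodule n

/-- The trace inner product `⟨X, Y⟩ = tr (X Y)` on `𝐒ⁿ`. -/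
instance (n : ℕ) : Inner ℝ (SymMat n) where
  inner X Y := ((X : Matrix (Fin n) (Fin n) ℝ) * (Y : Matrix (Fin n) (Fin n) ℝ)).trace

theorem SymMat.isHermitian {n : ℕ} (X : SymMat n) :
    (X : Matrix (Fin n) (Fin n) ℝ).IsHermitian := by
  have h : (X : Matrix (Fin n) (Fin n) ℝ).IsSymm := X.2
  rw [Matrix.IsHermitian, Matrix.conjTranspose_eq_transpose_of_trivial]
  exact h

/-- The eigenvalue map `λ : 𝐒ⁿ → ℝⁿ`: all eigenvalues with multiplicity, in nonincreasing order. -/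
def eigvec {n : ℕ} (X : SymMat n) : EuclideanSpace ℝ (Fin n) :=
  WithLp.toLp 2 fun i => X.isHermitian.eigenvalues₀ (Fin.cast (Fintype.card_fin n).symm i)

/-- `Λ(X) = Diag (λ(X))`. -/
def eigDiag {n : ℕ} (X : SymMat n) : Matrix (Fin n) (Fin n) ℝ :=
  Matrix.diagonal fun i => eigvec X i

/-- `𝐎ⁿ(X)`: the orthogonal matrices `U` with `X = U Λ(X) Uᵀ`. -/
def orthDecomp {n : ℕ} (X : SymMat n) : Set (Matrix (Fin n) (Fin n) ℝ) :=
  {U | U ∈ Matrix.orthogonalGroup (Fin n) ℝ ∧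
    (X : Matrix (Fin n) (Fin n) ℝ) = U * eigDiag X * U.transpose}

/-- The index set `{i | λᵢ(X) = c}`. -/
def eigIndex {n : ℕ} (X : SymMat n) (c : ℝ) : Finset (Fin n) :=
  Finset.univ.filter fun i => eigvec X i = c

/-- The submatrix `Z_I` formed by the columns of `Z` in `I`. -/
def colSub {n : ℕ} (Z : Matrix (Fin n) (Fin n) ℝ) (I : Finset (Fin n)) :
    Matrix (Fin n) I ℝ :=
  Z.submatrix id (fun i : I => (i : Fin n))

/-- The principal submatrix `Z_{II}`. -/
def prinSub {n : ℕ} (Z : Matrix (Fin n) (Fin n) ℝ) (I : Finset (Fin n)) : Matrix I I ℝ :=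
  Z.submatrix (fun i : I => (i : Fin n)) (fun i : I => (i : Fin n))

/-! ### The Moore–Penrose inverse -/

/-- The four Penrose equations: `B` is the Moore–Penrose inverse of `A`. -/
structure IsMoorePenrose {n : ℕ} (A B : Matrix (Fin n) (Fin n) ℝ) : Prop where
  mul_mul_left : A * B * A = A
  mul_mul_right : B * A * B = B
  symm_left : (A * B).IsSymm
  symm_right : (B * A).IsSymm

theorem IsMoorePenrose.unique {n : ℕ} {A B C : Matrix (Fin n) (Fin n) ℝ}
    (hB : IsMoorePenrose A B) (hC : IsMoorePenrose A C) : B = C := by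
  have h1 : A * B = A * C := by
    calc A * B = (A * B).transpose := hB.symm_left.symm
      _ = ((A * C) * (A * B)).transpose := by
          rw [← Matrix.mul_assoc (A * C), hC.mul_mul_left]
      _ = (A * B).transpose * (A * C).transpose := Matrix.transpose_mul _ _
      _ = (A * B) * (A * C) := by rw [hB.symm_left.eq, hC.symm_left.eq]
      _ = A * C := by rw [← Matrix.mul_assoc, hB.mul_mul_left]
  have h2 : B * A = C * A := by
    calc B * A = (B * A).transpose := hB.symm_right.symm
      _ = ((B * A) * (C * A)).transpose := by
          rw [Matrix.mul_assoc B A, ← Matrix.mul_assoc A C, hC.mul_mul_left]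
      _ = (C * A).transpose * (B * A).transpose := Matrix.transpose_mul _ _
      _ = (C * A) * (B * A) := by rw [hB.symm_right.eq, hC.symm_right.eq]
      _ = C * A := by rw [Matrix.mul_assoc C A, ← Matrix.mul_assoc A B, hB.mul_mul_left]
  calc B = B * A * B := hB.mul_mul_right.symm
    _ = C * A * C := by rw [h2, Matrix.mul_assoc, h1, Matrix.mul_assoc]
    _ = C := hC.mul_mul_right

theorem exists_isMoorePenrose_of_isHermitian {n : ℕ} {A : Matrix (Fin n) (Fin n) ℝ}
    (hA : A.IsHermitian) : ∃ B, IsMoorePenrose A B ∧ B.IsSymm := by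
  obtain ⟨V, d, hV, hA'⟩ : ∃ (V : Matrix (Fin n) (Fin n) ℝ) (d : Fin n → ℝ),
      V.transpose * V = 1 ∧ A = V * Matrix.diagonal d * V.transpose := by
    refine ⟨hA.eigenvectorUnitary, hA.eigenvalues, ?_, ?_⟩
    · have := (Matrix.mem_unitaryGroup_iff').1 hA.eigenvectorUnitary.2
      simpa [Matrix.star_eq_conjTranspose, Matrix.conjTranspose_eq_transpose_of_trivial] using this
    · have := hA.spectral_theorem
      rw [Unitary.conjStarAlgAut_apply] at this
      simpa [Matrix.star_eq_conjTranspose, Matrix.conjTranspose_eq_transpose_of_trivial,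
        Function.comp_def] using this
  have key : ∀ e f : Fin n → ℝ, (V * Matrix.diagonal e * V.transpose) *
      (V * Matrix.diagonal f * V.transpose) =
      V * Matrix.diagonal (fun i => e i * f i) * V.transpose := by
    intro e f
    calc _ = V * Matrix.diagonal e * (V.transpose * V) * Matrix.diagonal f * V.transpose := by
            simp only [Matrix.mul_assoc]
      _ = _ := by rw [hV, Matrix.mul_one, Matrix.mul_assoc V, Matrix.diagonal_mul_diagonal]
  have symm : ∀ e : Fin n → ℝ, (V * Matrix.diagonal e * V.transpose).IsSymm := by
    intro e
    simp [Matrix.IsSymm, Matrix.transpose_mul, Matrix.mul_assoc]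
  refine ⟨V * Matrix.diagonal (fun i => (d i)⁻¹) * V.transpose, ⟨?_, ?_, ?_, ?_⟩, symm _⟩
  · rw [hA', key, key]; simp
  · rw [hA', key, key]; congr 3; funext i; by_cases h : d i = 0 <;> simp [h]
  · rw [hA', key]; exact symm _
  · rw [hA', key]; exact symm _

theorem exists_isMoorePenrose {n : ℕ} (A : Matrix (Fin n) (Fin n) ℝ) :
    ∃ B, IsMoorePenrose A B := by
  have hS : (A.transpose * A).IsHermitian := by
    rw [← Matrix.conjTranspose_eq_transpose_of_trivial]
    exact Matrix.isHermitian_conjTranspose_mul_self A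
  obtain ⟨G, hG, hGs⟩ := exists_isMoorePenrose_of_isHermitian hS
  have h0 : A * (1 - G * (A.transpose * A)) = 0 := by
    rw [← Matrix.conjTranspose_mul_self_eq_zero,
      Matrix.conjTranspose_eq_transpose_of_trivial, Matrix.transpose_mul, Matrix.mul_assoc,
      ← Matrix.mul_assoc A.transpose A, Matrix.mul_sub, Matrix.mul_one, ← Matrix.mul_assoc _ G,
      hG.mul_mul_left, sub_self, Matrix.mul_zero]
  refine ⟨G * A.transpose, ⟨?_, ?_, ?_, ?_⟩⟩
  · rw [Matrix.mul_sub, Matrix.mul_one, sub_eq_zero] at h0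
    simpa only [Matrix.mul_assoc] using h0.symm
  · have h2 : G * (A.transpose * A) * G = G := hG.mul_mul_right
    calc G * A.transpose * A * (G * A.transpose)
        = G * (A.transpose * A) * G * A.transpose := by simp only [Matrix.mul_assoc]
      _ = G * A.transpose := by rw [h2]
  · simp [Matrix.IsSymm, Matrix.transpose_mul, Matrix.mul_assoc, hGs.eq]
  · rw [Matrix.mul_assoc]
    exact hG.symm_right

/-- The Moore–Penrose inverse `A†` of a real square matrix. -/
def pinv {n : ℕ} (A : Matrix (Fin n) (Fin n) ℝ) : Matrix (Fin n) (Fin n) ℝ :=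
  Classical.choose (exists_isMoorePenrose A)

theorem pinv_spec {n : ℕ} (A : Matrix (Fin n) (Fin n) ℝ) : IsMoorePenrose A (pinv A) :=
  Classical.choose_spec (exists_isMoorePenrose A)

/-! ### Variational notions for extended-real-valued functions -/

/-- Convexity of an extended-real-valued function: its epigraph is convex. -/
def EConvex {E : Type*} [AddCommGroup E] [Module ℝ E] (f : E → EReal) : Prop :=
  Convex ℝ {p : E × ℝ | f p.1 ≤ (p.2 : EReal)}

/-- The subdifferential of convex analysis, at a point where `f` is finite (empty elsewhere). -/
def subdiff {E : Type*} [AddCommGroup E] [Inner ℝ E] (f : E → EReal) (x : E) : Set E :=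
  {v | f x ≠ ⊥ ∧ f x ≠ ⊤ ∧ ∀ y, f x + ((inner ℝ v (y - x) : ℝ) : EReal) ≤ f y}

/-- The second-order difference quotient
`(f(x + t w) - f(x) - t ⟨v, w⟩) / (t² / 2)`, for `f(x)` finite and `t > 0`. -/
def secondQuot {E : Type*} [AddCommGroup E] [Module ℝ E] [Inner ℝ E]
    (f : E → EReal) (x v : E) (t : ℝ) (w : E) : EReal :=
  (f (x + t • w) - f x - ((t * inner ℝ v w : ℝ) : EReal)) / ((t ^ 2 / 2 : ℝ) : EReal)

/-- The second subderivative `d²f(x, v)(w)`: the lower limit of the second-order difference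
quotients as `t ↓ 0` and `w' → w`. -/
def secondSubderiv {E : Type*} [AddCommGroup E] [Module ℝ E] [TopologicalSpace E] [Inner ℝ E]
    (f : E → EReal) (x v w : E) : EReal :=
  liminf (fun p : ℝ × E => secondQuot f x v p.1 p.2) (𝓝[>] (0 : ℝ) ×ˢ 𝓝 w)

/-- `d` is the one-sided directional derivative of `F` at `x` in the direction `h`. -/
def HasDirDeriv {E G : Type*} [AddCommGroup E] [Module ℝ E] [AddCommGroup G] [Module ℝ G]
    [TopologicalSpace G] (F : E → G) (x h : E) (d : G) : Prop :=
  Tendsto (fun t : ℝ => t⁻¹ • (F (x + t • h) - F x)) (𝓝[>] (0 : ℝ)) (𝓝 d)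

/-- The one-sided directional derivative `F'(x; h)`, meaningful when the limit exists. -/
def dirDeriv {E G : Type*} [AddCommGroup E] [Module ℝ E] [AddCommGroup G] [Module ℝ G]
    [TopologicalSpace G] (F : E → G) (x h : E) : G :=
  haveI : Nonempty G := ⟨0⟩
  limUnder (𝓝[>] (0 : ℝ)) fun t : ℝ => t⁻¹ • (F (x + t • h) - F x)

/-- A function on `ℝⁿ` is symmetric if it is invariant under permutations of the coordinates. -/
def IsSymmFun {n : ℕ} (θ : EuclideanSpace ℝ (Fin n) → EReal) : Prop :=
  ∀ (σ : Equiv.Perm (Fin n)) (x : EuclideanSpace ℝ (Fin n)),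
    θ (WithLp.toLp 2 fun i => x (σ i)) = θ x

end SpectralFun

end

open SpectralFun

noncomputable section

namespace SpectralFun

open Matrix

/-! ### The trace inequality for ordered eigenvalues -/

/-! Put `w = (λ(X+tK) - λ(X))/t`. The difference quotient of `g` at `(t, K)` equals that of `θ` at
`(t, w)` plus the real number `(⟨λ(Y), λ(X+tK)⟩ - ⟨λ(Y), λ(X)⟩ - t⟨Y, K⟩) / (t²/2)`
(`secondQuot_comp_eigvec`). It remains to bound the lower limits of the two summands separately.

The first needs `w → λ'(X; H)` as `t ↓ 0` and `K → H` jointly. By Fan's inequality, sums of the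
largest eigenvalues are maxima of linear functionals, hence convex and Lipschitz, and each
eigenvalue is a difference of two such sums (`exists_tendsto_eigvec`).

For the second, Fan's inequality bounds `⟨λ(Y), λ(X+tK)⟩` below by the trace of `X+tK` against any
orthogonal conjugate of `Y`. A curve of rotations tangent to a skew matrix `A` makes this bound
explicit to second order. The right `A`, which depends on `H` but not on `K`, produces the sum over
blocks in the limit (`tendsto_rotated_lower_bound`). Only a one-sided bound is needed, so no
perturbation theory of eigenvectors enters. -/

theorem eigvec_antitone {n : ℕ} (X : SymMat n) : Antitone fun i => eigvec X i := by
  intro i j hij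
  exact X.isHermitian.eigenvalues₀_antitone hij

theorem orthDecomp_nonempty {n : ℕ} (X : SymMat n) : (orthDecomp X).Nonempty := by
  have hA := X.isHermitian
  -- The columns of `eigenvectorUnitary` follow an arbitrary enumeration of the index type; `e` puts
  -- them in nonincreasing order of eigenvalue.
  set e : Fin n ≃ Fin n := (finCongr (Fintype.card_fin n).symm).trans
    (Fintype.equivOfCardEq (Fintype.card_fin _))
  set V : Matrix (Fin n) (Fin n) ℝ := (hA.eigenvectorUnitary : Matrix (Fin n) (Fin n) ℝ)
  have hV : Vᵀ * V = 1 := by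
    have := (Matrix.mem_unitaryGroup_iff').1 hA.eigenvectorUnitary.2
    simpa [V, Matrix.star_eq_conjTranspose, Matrix.conjTranspose_eq_transpose_of_trivial] using this
  have hX : (X : Matrix (Fin n) (Fin n) ℝ) = V * diagonal hA.eigenvalues * Vᵀ := by
    have := hA.spectral_theorem
    rw [Unitary.conjStarAlgAut_apply] at this
    simpa [V, Matrix.star_eq_conjTranspose, Matrix.conjTranspose_eq_transpose_of_trivial,
      Function.comp_def] using this
  have hd : eigDiag X = (diagonal hA.eigenvalues).submatrix e e := by
    rw [submatrix_diagonal_equiv]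
    refine congrArg diagonal (funext fun i => ?_)
    simp [eigvec, Matrix.IsHermitian.eigenvalues, e]
  refine ⟨V.submatrix id e, ?_, ?_⟩
  · rw [Matrix.mem_orthogonalGroup_iff', transpose_submatrix,
      ← submatrix_mul _ _ _ id _ Function.bijective_id, hV]
    simp
  · rw [hd, transpose_submatrix, submatrix_mul_equiv, submatrix_mul_equiv, submatrix_id_id]
    exact hX

/-- The left side is linear in `M`, so by Birkhoff's theorem it suffices to check permutation
matrices, where this is the rearrangement inequality. -/
theorem sum_mul_mul_le_of_doublyStochastic {n : ℕ} {M : Matrix (Fin n) (Fin n) ℝ}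
    (hM : M ∈ doublyStochastic ℝ (Fin n)) {a b : Fin n → ℝ} (ha : Antitone a) (hb : Antitone b) :
    ∑ i, ∑ j, M i j * (a i * b j) ≤ ∑ i, a i * b i := by
  have hsub : (doublyStochastic ℝ (Fin n) : Set (Matrix (Fin n) (Fin n) ℝ)) ⊆
      {M | ∑ i, ∑ j, M i j * (a i * b j) ≤ ∑ i, a i * b i} := by
    rw [doublyStochastic_eq_convexHull_permMatrix]
    refine convexHull_min ?_ ?_
    · rintro _ ⟨σ, rfl⟩
      have hab : Monovary a b := by
        intro i j h
        exact ha (le_of_lt (hb.reflect_lt h))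
      have h := hab.sum_mul_comp_perm_le_sum_mul (σ := σ)
      simpa [Equiv.Perm.permMatrix, PEquiv.toMatrix_apply, eq_comm] using h
    · refine convex_halfSpace_le (f := fun M : Matrix (Fin n) (Fin n) ℝ =>
        ∑ i, ∑ j, M i j * (a i * b j)) ⟨fun M N => ?_, fun c M => ?_⟩ _
      · simp [add_mul, Finset.sum_add_distrib]
      · simp [Finset.mul_sum, mul_assoc]
  exact hsub hM

theorem sq_entries_mem_doublyStochastic {n : ℕ} {P : Matrix (Fin n) (Fin n) ℝ}
    (hP : P ∈ orthogonalGroup (Fin n) ℝ) :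
    Matrix.of (fun i j => P i j ^ 2) ∈ doublyStochastic ℝ (Fin n) := by
  rw [mem_doublyStochastic_iff_sum]
  refine ⟨fun i j => sq_nonneg _, fun i => ?_, fun j => ?_⟩
  · have h := congrFun (congrFun ((Matrix.mem_orthogonalGroup_iff _ _).1 hP) i) i
    simpa [Matrix.mul_apply, sq] using h
  · have h := congrFun (congrFun ((Matrix.mem_orthogonalGroup_iff' _ _).1 hP) j) j
    simpa [Matrix.mul_apply, sq] using h

theorem trace_conj_diagonal_mul_diagonal {n : ℕ} (P : Matrix (Fin n) (Fin n) ℝ)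
    (a b : Fin n → ℝ) :
    (P * diagonal b * Pᵀ * diagonal a).trace = ∑ i, ∑ j, P i j ^ 2 * (a i * b j) := by
  rw [Matrix.trace]
  refine Finset.sum_congr rfl fun i _ => ?_
  rw [Matrix.diag_apply, Matrix.mul_diagonal, Matrix.mul_apply, Finset.sum_mul]
  refine Finset.sum_congr rfl fun j _ => ?_
  rw [Matrix.mul_diagonal, Matrix.transpose_apply]
  ring

theorem transpose_mul_self_of_mem_orthogonalGroup {n : ℕ} {V : Matrix (Fin n) (Fin n) ℝ}
    (hV : V ∈ orthogonalGroup (Fin n) ℝ) : Vᵀ * V = 1 := by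
  simpa [star_eq_conjTranspose, conjTranspose_eq_transpose_of_trivial] using
    (Matrix.mem_orthogonalGroup_iff' _ _).1 hV

theorem mul_transpose_self_of_mem_orthogonalGroup {n : ℕ} {V : Matrix (Fin n) (Fin n) ℝ}
    (hV : V ∈ orthogonalGroup (Fin n) ℝ) : V * Vᵀ = 1 := by
  simpa [star_eq_conjTranspose, conjTranspose_eq_transpose_of_trivial] using
    (Matrix.mem_orthogonalGroup_iff _ _).1 hV

theorem mem_orthogonalGroup_of_transpose_mul_self {n : ℕ} {V : Matrix (Fin n) (Fin n) ℝ}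
    (hV : Vᵀ * V = 1) : V ∈ orthogonalGroup (Fin n) ℝ := by
  rw [Matrix.mem_orthogonalGroup_iff']
  simpa [star_eq_conjTranspose, conjTranspose_eq_transpose_of_trivial] using hV

/-- The Fan–von Neumann trace inequality. -/
theorem trace_conj_diagonal_mul_le {n : ℕ} {V : Matrix (Fin n) (Fin n) ℝ}
    (hV : V ∈ orthogonalGroup (Fin n) ℝ) {d : Fin n → ℝ} (hd : Antitone d) (Z : SymMat n) :
    (V * diagonal d * Vᵀ * (Z : Matrix (Fin n) (Fin n) ℝ)).trace ≤ ∑ i, d i * eigvec Z i := by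
  obtain ⟨W, hW, hZ⟩ := orthDecomp_nonempty Z
  have hWt := mul_transpose_self_of_mem_orthogonalGroup hW
  have hP : Wᵀ * V ∈ orthogonalGroup (Fin n) ℝ := by
    apply mem_orthogonalGroup_of_transpose_mul_self
    rw [transpose_mul, transpose_transpose, Matrix.mul_assoc, ← Matrix.mul_assoc W, hWt,
      Matrix.one_mul, transpose_mul_self_of_mem_orthogonalGroup hV]
  -- In the eigenbasis `W` of `Z` the trace becomes a bilinear form whose weights, the squared
  -- entries of `Wᵀ * V`, are doubly stochastic.
  calc (V * diagonal d * Vᵀ * (Z : Matrix (Fin n) (Fin n) ℝ)).trace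
      = ((Wᵀ * V) * diagonal d * (Wᵀ * V)ᵀ * eigDiag Z).trace := by
        rw [hZ, transpose_mul, transpose_transpose]
        simp only [Matrix.mul_assoc]
        rw [Matrix.trace_mul_comm Wᵀ]
        simp only [Matrix.mul_assoc]
    _ = ∑ i, ∑ j, (Wᵀ * V) i j ^ 2 * (eigvec Z i * d j) :=
        trace_conj_diagonal_mul_diagonal _ _ _
    _ ≤ ∑ i, eigvec Z i * d i :=
        sum_mul_mul_le_of_doublyStochastic (sq_entries_mem_doublyStochastic hP)
          (eigvec_antitone Z) hd
    _ = ∑ i, d i * eigvec Z i := Finset.sum_congr rfl fun i _ => mul_comm _ _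

/-- The equality case of Fan's inequality. Together they exhibit the weighted eigenvalue sum as a
maximum of linear functionals of `Z`. -/
theorem trace_conj_diagonal_mul_eq {n : ℕ} {Z : SymMat n} {V : Matrix (Fin n) (Fin n) ℝ}
    (hV : V ∈ orthDecomp Z) (d : Fin n → ℝ) :
    (V * diagonal d * Vᵀ * (Z : Matrix (Fin n) (Fin n) ℝ)).trace = ∑ i, d i * eigvec Z i := by
  have hVt := transpose_mul_self_of_mem_orthogonalGroup hV.1
  calc (V * diagonal d * Vᵀ * (Z : Matrix (Fin n) (Fin n) ℝ)).trace
      = (V * (diagonal d * (Vᵀ * V) * eigDiag Z * Vᵀ)).trace := by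
        rw [hV.2]; simp only [Matrix.mul_assoc]
    _ = (diagonal d * (Vᵀ * V) * eigDiag Z * (Vᵀ * V)).trace := by
        rw [Matrix.trace_mul_comm]; simp only [Matrix.mul_assoc]
    _ = _ := by
        rw [hVt, Matrix.mul_one, Matrix.mul_one, eigDiag, diagonal_mul_diagonal, trace_diagonal]

/-! ### Directional differentiability of the eigenvalue map -/

/-- The weighted sum of the ordered eigenvalues. -/
def eigSum {n : ℕ} (d : Fin n → ℝ) (Z : SymMat n) : ℝ := ∑ i, d i * eigvec Z i

/-- A maximum of linear functionals is convex: the functional optimal at the convex combination is a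
competitor at both endpoints. -/
theorem eigSum_convexOn {n : ℕ} {d : Fin n → ℝ} (hd : Antitone d) :
    ConvexOn ℝ Set.univ (eigSum d : SymMat n → ℝ) := by
  refine ⟨convex_univ, fun Z _ W _ a b ha hb _ => ?_⟩
  obtain ⟨V, hV⟩ := orthDecomp_nonempty (a • Z + b • W)
  have h := trace_conj_diagonal_mul_eq hV d
  have h1 := trace_conj_diagonal_mul_le hV.1 hd Z
  have h2 := trace_conj_diagonal_mul_le hV.1 hd W
  simp only [Submodule.coe_add, Submodule.coe_smul, Matrix.mul_add, Matrix.mul_smul,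
    Matrix.trace_add, Matrix.trace_smul, smul_eq_mul] at h
  simp only [eigSum, smul_eq_mul]
  rw [← h]
  gcongr

theorem abs_entry_le_one {n : ℕ} {P : Matrix (Fin n) (Fin n) ℝ}
    (hP : P ∈ orthogonalGroup (Fin n) ℝ) (i j : Fin n) : |P i j| ≤ 1 := by
  have h := (mem_doublyStochastic_iff_sum.1 (sq_entries_mem_doublyStochastic hP)).2.1 i
  rw [← sq_le_one_iff_abs_le_one, ← h]
  exact Finset.single_le_sum (f := fun j => P i j ^ 2) (fun _ _ => sq_nonneg _) (Finset.mem_univ j)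

theorem abs_trace_conj_diagonal_mul_le {n : ℕ} {V : Matrix (Fin n) (Fin n) ℝ}
    (hV : V ∈ orthogonalGroup (Fin n) ℝ) (d : Fin n → ℝ) (K : Matrix (Fin n) (Fin n) ℝ) :
    |(V * diagonal d * Vᵀ * K).trace| ≤ (∑ k, |d k|) * ∑ i, ∑ j, |K i j| := by
  have hent : ∀ i j, |(V * diagonal d * Vᵀ) i j| ≤ ∑ k, |d k| := by
    intro i j
    rw [Matrix.mul_apply]
    refine (Finset.abs_sum_le_sum_abs _ _).trans (Finset.sum_le_sum fun k _ => ?_)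
    rw [Matrix.mul_diagonal, Matrix.transpose_apply, abs_mul, abs_mul]
    have h1 := abs_entry_le_one hV i k
    have h2 := abs_entry_le_one hV j k
    calc |V i k| * |d k| * |V j k| ≤ 1 * |d k| * 1 := by gcongr
      _ = |d k| := by ring
  rw [Matrix.trace_mul_comm, Matrix.trace, Finset.mul_sum]
  refine (Finset.abs_sum_le_sum_abs _ _).trans (Finset.sum_le_sum fun i _ => ?_)
  rw [Matrix.diag_apply, Matrix.mul_apply, Finset.mul_sum]
  refine (Finset.abs_sum_le_sum_abs _ _).trans (Finset.sum_le_sum fun j _ => ?_)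
  rw [abs_mul, mul_comm]
  exact mul_le_mul_of_nonneg_right (hent j i) (abs_nonneg _)

/-- Lipschitz continuity: the functional optimal at one point is a competitor at the other, and all
these functionals share one bound in the entrywise `ℓ¹` norm. -/
theorem eigSum_sub_le {n : ℕ} {d : Fin n → ℝ} (hd : Antitone d) (Z W : SymMat n) :
    |eigSum d Z - eigSum d W| ≤ (∑ k, |d k|) *
      ∑ i, ∑ j, |((Z - W : SymMat n) : Matrix (Fin n) (Fin n) ℝ) i j| := by
  have key : ∀ Z W : SymMat n, eigSum d Z - eigSum d W ≤ (∑ k, |d k|) *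
      ∑ i, ∑ j, |((Z - W : SymMat n) : Matrix (Fin n) (Fin n) ℝ) i j| := by
    intro Z W
    obtain ⟨V, hV⟩ := orthDecomp_nonempty Z
    refine le_trans ?_ ((le_abs_self _).trans (abs_trace_conj_diagonal_mul_le hV.1 d _))
    have h1 := trace_conj_diagonal_mul_eq hV d
    have h2 := trace_conj_diagonal_mul_le hV.1 hd W
    rw [Submodule.coe_sub, Matrix.mul_sub, Matrix.trace_sub, h1]
    simp only [eigSum]
    linarith
  rw [abs_le']
  refine ⟨key Z W, ?_⟩
  rw [neg_sub]
  refine (key W Z).trans (le_of_eq ?_)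
  congr 1
  refine Finset.sum_congr rfl fun i _ => Finset.sum_congr rfl fun j _ => ?_
  simp only [Submodule.coe_sub, Matrix.sub_apply]
  exact abs_sub_comm _ _

/-- Uniform (Hadamard) directional differentiability. -/
theorem exists_tendsto_eigSum {n : ℕ} {d : Fin n → ℝ} (hd : Antitone d) (X H : SymMat n) :
    ∃ l : ℝ, Tendsto (fun p : ℝ × SymMat n => p.1⁻¹ * (eigSum d (X + p.1 • p.2) - eigSum d X))
      (𝓝[>] (0 : ℝ) ×ˢ 𝓝 H) (𝓝 l) := by
  -- Along a fixed direction the function is convex in one real variable, so its right derivative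
  -- exists.
  have hc : ConvexOn ℝ Set.univ fun t : ℝ => eigSum d (X + t • H) := by
    have := (eigSum_convexOn hd).comp_affineMap (AffineMap.lineMap X (X + H) : ℝ →ᵃ[ℝ] SymMat n)
    simpa [Function.comp_def, AffineMap.lineMap_apply, add_comm] using this
  have hder := hc.hasDerivWithinAt_rightDeriv_of_mem_interior (x := 0) (by simp)
  rw [hasDerivWithinAt_iff_tendsto_slope' (by simp)] at hder
  refine ⟨derivWithin (fun t : ℝ => eigSum d (X + t • H)) (Set.Ioi 0) 0, ?_⟩
  have h1 : Tendsto (fun p : ℝ × SymMat n => p.1⁻¹ * (eigSum d (X + p.1 • H) - eigSum d X))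
      (𝓝[>] (0 : ℝ) ×ˢ 𝓝 H)
      (𝓝 (derivWithin (fun t : ℝ => eigSum d (X + t • H)) (Set.Ioi 0) 0)) := by
    refine (hder.comp tendsto_fst).congr fun p => ?_
    simp [slope_def_field, div_eq_inv_mul]
  -- The Lipschitz bound makes the cost of replacing the direction `p.2` by `H` vanish uniformly in
  -- `t`.
  have h2 : Tendsto (fun p : ℝ × SymMat n => p.1⁻¹ * (eigSum d (X + p.1 • p.2) -
      eigSum d (X + p.1 • H))) (𝓝[>] (0 : ℝ) ×ˢ 𝓝 H) (𝓝 0) := by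
    have hb : Tendsto (fun p : ℝ × SymMat n => (∑ k, |d k|) *
        ∑ i, ∑ j, |((p.2 - H : SymMat n) : Matrix (Fin n) (Fin n) ℝ) i j|)
        (𝓝[>] (0 : ℝ) ×ˢ 𝓝 H) (𝓝 0) := by
      have hcont : Continuous fun K : SymMat n => (∑ k, |d k|) *
          ∑ i, ∑ j, |((K - H : SymMat n) : Matrix (Fin n) (Fin n) ℝ) i j| := by
        refine continuous_const.mul (continuous_finsetSum _ fun i _ =>
          continuous_finsetSum _ fun j _ => Continuous.abs ?_)
        exact (continuous_subtype_val.comp (continuous_id.sub continuous_const)).matrix_elem i j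
      have := (hcont.tendsto H).comp (tendsto_snd (f := 𝓝[>] (0 : ℝ)))
      simpa [Function.comp_def] using this
    refine squeeze_zero_norm' ?_ hb
    have hpos : ∀ᶠ p : ℝ × SymMat n in 𝓝[>] (0 : ℝ) ×ˢ 𝓝 H, 0 < p.1 :=
      tendsto_fst.eventually self_mem_nhdsWithin
    filter_upwards [hpos] with p hp
    have h := eigSum_sub_le hd (X + p.1 • p.2) (X + p.1 • H)
    have hs : X + p.1 • p.2 - (X + p.1 • H) = p.1 • (p.2 - H) := by module
    rw [hs] at h
    simp only [Submodule.coe_smul, Matrix.smul_apply, smul_eq_mul, abs_mul, abs_of_pos hp,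
      ← Finset.mul_sum] at h
    rw [Real.norm_eq_abs, abs_mul, abs_of_pos (inv_pos.2 hp), inv_mul_le_iff₀ hp]
    linarith
  have h3 := h1.add h2
  rw [add_zero] at h3
  refine h3.congr fun p => ?_
  ring

/-- Each eigenvalue is the sum of those up to index `i` minus the sum of those before `i`, and both
weight vectors are antitone. -/
theorem exists_tendsto_eigvec {n : ℕ} (X H : SymMat n) :
    ∃ l : EuclideanSpace ℝ (Fin n),
      Tendsto (fun p : ℝ × SymMat n => p.1⁻¹ • (eigvec (X + p.1 • p.2) - eigvec X))
        (𝓝[>] (0 : ℝ) ×ˢ 𝓝 H) (𝓝 l) := by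
  have hcoord : ∀ i : Fin n, ∃ l : ℝ, Tendsto (fun p : ℝ × SymMat n =>
      p.1⁻¹ * (eigvec (X + p.1 • p.2) i - eigvec X i)) (𝓝[>] (0 : ℝ) ×ˢ 𝓝 H) (𝓝 l) := by
    intro i
    have a1 : Antitone fun j : Fin n => if j ≤ i then (1 : ℝ) else 0 := by
      intro j k hjk
      dsimp only
      split_ifs with h1 h2
      · exact le_rfl
      · exact absurd (hjk.trans h1) h2
      · exact zero_le_one
      · exact le_rfl
    have a2 : Antitone fun j : Fin n => if j < i then (1 : ℝ) else 0 := by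
      intro j k hjk
      dsimp only
      split_ifs with h1 h2
      · exact le_rfl
      · exact absurd (hjk.trans_lt h1) h2
      · exact zero_le_one
      · exact le_rfl
    have hsplit : ∀ Z : SymMat n, eigvec Z i = eigSum (fun j => if j ≤ i then (1 : ℝ) else 0) Z -
        eigSum (fun j => if j < i then (1 : ℝ) else 0) Z := by
      intro Z
      rw [eigSum, eigSum, ← Finset.sum_sub_distrib, Finset.sum_eq_single i]
      · simp
      · intro j _ hj
        have : j ≤ i ↔ j < i := ⟨fun h => lt_of_le_of_ne h hj, le_of_lt⟩
        simp [this]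
      · simp
    obtain ⟨l1, h1⟩ := exists_tendsto_eigSum a1 X H
    obtain ⟨l2, h2⟩ := exists_tendsto_eigSum a2 X H
    refine ⟨l1 - l2, (h1.sub h2).congr fun p => ?_⟩
    rw [hsplit, hsplit]
    ring
  choose l hl using hcoord
  refine ⟨WithLp.toLp 2 l, ?_⟩
  have := ((PiLp.continuous_toLp 2 fun _ : Fin n => ℝ).tendsto l).comp (tendsto_pi_nhds.2 hl)
  refine this.congr fun p => ?_
  ext i
  simp

/-! ### Cayley rotations -/

/-- The two Cayley factors commute, and transposition exchanges `1 - B` with `1 + B`. -/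
theorem cayley_mem_orthogonalGroup {n : ℕ} {B R : Matrix (Fin n) (Fin n) ℝ} (hB : Bᵀ = -B)
    (hR : R * (1 - B) = 1) : R * (1 + B) ∈ orthogonalGroup (Fin n) ℝ := by
  have hR' : (1 - B) * R = 1 := mul_eq_one_comm.1 hR
  have hRt : Rᵀ * (1 + B) = 1 := by
    have := congrArg transpose hR'
    simpa [transpose_mul, hB, sub_neg_eq_add] using this
  apply mem_orthogonalGroup_of_transpose_mul_self
  have hcomm : R * (1 + B) = (1 + B) * R := by
    have e1 : (1 : Matrix (Fin n) (Fin n) ℝ) + B = 2 - (1 - B) := by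
      rw [← one_add_one_eq_two]; abel
    rw [e1, Matrix.mul_sub, Matrix.sub_mul, hR, hR', mul_two, two_mul]
  rw [transpose_mul, transpose_add, transpose_one, hB, ← sub_eq_add_neg, Matrix.mul_assoc, hcomm,
    ← Matrix.mul_assoc Rᵀ, hRt, Matrix.one_mul, hR']

/-- Sandwiching `Y` as `R(1 - B)Y(1 + B)Rᵀ` gives both terms the same outer factors. The increment
is then an exact commutator expression, with no Taylor remainder to estimate. -/
theorem cayley_conj_sub {n : ℕ} {B R : Matrix (Fin n) (Fin n) ℝ} (hB : Bᵀ = -B)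
    (hR : R * (1 - B) = 1) (Y : Matrix (Fin n) (Fin n) ℝ) :
    (R * (1 + B)) * Y * (R * (1 + B))ᵀ - Y = 2 • (R * (B * Y - Y * B) * Rᵀ) := by
  have hRt : (1 + B) * Rᵀ = 1 := by
    have := congrArg transpose hR
    simpa [transpose_mul, hB, sub_neg_eq_add] using this
  have hY : Y = R * (1 - B) * Y * ((1 + B) * Rᵀ) := by
    rw [hR, hRt, Matrix.one_mul, Matrix.mul_one]
  have ht : (R * (1 + B))ᵀ = (1 - B) * Rᵀ := by
    rw [transpose_mul, transpose_add, transpose_one, hB, ← sub_eq_add_neg]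
  rw [ht]
  nth_rewrite 2 [hY]
  noncomm_ring

/-- The second-order expansion function of the rotated trace; `R` stands for `(1 - (t/2) A)⁻¹`. -/
def rotQuot {n : ℕ} (A C x : Matrix (Fin n) (Fin n) ℝ) (R : Matrix (Fin n) (Fin n) ℝ) (t : ℝ)
    (K : Matrix (Fin n) (Fin n) ℝ) : ℝ :=
  (R * A * C * x).trace + (C * Aᵀ * Rᵀ * x).trace +
    t / 2 * (R * A * C * Aᵀ * Rᵀ * x).trace + 2 * (R * C * Rᵀ * K).trace

/-- The apparent pole at `t = 0` cancels because `tr(Cx) = 0`; substituting `R = 1 + (t/2)RA` once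
on each side of `C` leaves an expression continuous at `t = 0`. -/
theorem rotQuot_eq {n : ℕ} {A C x R K : Matrix (Fin n) (Fin n) ℝ} {t : ℝ} (ht : t ≠ 0)
    (hR : R * (1 - (t / 2) • A) = 1) (hCx : (C * x).trace = 0) :
    rotQuot A C x R t K = 2 / t * (R * C * Rᵀ * (x + t • K)).trace := by
  have h1 : R = 1 + (t / 2) • (R * A) := by
    rw [Matrix.mul_sub, Matrix.mul_one, Matrix.mul_smul] at hR
    rw [← hR]; abel
  have h2 : Rᵀ = 1 + (t / 2) • (Aᵀ * Rᵀ) := by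
    have := congrArg transpose h1
    simpa [transpose_mul] using this
  have h3 : (R * C * Rᵀ * x).trace = t / 2 * ((R * A * C * x).trace + (C * Aᵀ * Rᵀ * x).trace +
      t / 2 * (R * A * C * Aᵀ * Rᵀ * x).trace) := by
    have h4 : R * C * Rᵀ * x = C * x + (t / 2) • (R * A * C * x + C * Aᵀ * Rᵀ * x +
        (t / 2) • (R * A * C * Aᵀ * Rᵀ * x)) := by
      calc R * C * Rᵀ * x
          = (1 + (t / 2) • (R * A)) * C * (1 + (t / 2) • (Aᵀ * Rᵀ)) * x := by rw [← h1, ← h2]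
        _ = _ := by
          simp only [Matrix.add_mul, Matrix.mul_add, Matrix.one_mul, Matrix.mul_one,
            Matrix.smul_mul, Matrix.mul_smul, smul_add, Matrix.mul_assoc]
          abel
    rw [h4]
    simp only [Matrix.trace_add, Matrix.trace_smul, smul_eq_mul, hCx, zero_add]
  rw [Matrix.mul_add, Matrix.mul_smul, Matrix.trace_add, Matrix.trace_smul, h3, rotQuot,
    smul_eq_mul]
  field_simp

theorem tendsto_rotQuot {n : ℕ} (A C x K : Matrix (Fin n) (Fin n) ℝ) :
    Tendsto (fun p : ℝ × Matrix (Fin n) (Fin n) ℝ =>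
      rotQuot A C x (1 - (p.1 / 2) • A)⁻¹ p.1 p.2) (𝓝 (0, K))
      (𝓝 ((A * C * x).trace + (C * Aᵀ * x).trace + 2 * (C * K).trace)) := by
  have hcont : ContinuousAt (fun t : ℝ => (1 - (t / 2) • A)⁻¹) 0 := by
    have hM : Continuous fun t : ℝ => 1 - (t / 2) • A := by fun_prop
    simp only [Matrix.inv_def, Ring.inverse_eq_inv']
    refine ContinuousAt.smul (ContinuousAt.inv₀ hM.matrix_det.continuousAt ?_)
      hM.matrix_adjugate.continuousAt
    simp
  have hG : Continuous fun q : Matrix (Fin n) (Fin n) ℝ × ℝ × Matrix (Fin n) (Fin n) ℝ =>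
      rotQuot A C x q.1 q.2.1 q.2.2 := by
    unfold rotQuot
    fun_prop
  have hcomp : ContinuousAt (fun p : ℝ × Matrix (Fin n) (Fin n) ℝ =>
      rotQuot A C x (1 - (p.1 / 2) • A)⁻¹ p.1 p.2) (0, K) :=
    hG.continuousAt.comp (f := fun p : ℝ × Matrix (Fin n) (Fin n) ℝ =>
      ((1 - (p.1 / 2) • A)⁻¹, p.1, p.2))
      ((ContinuousAt.comp (f := Prod.fst) (x := ((0 : ℝ), K)) hcont continuousAt_fst).prodMk
        continuousAt_id)
  have hv : rotQuot A C x (1 - ((0 : ℝ) / 2) • A)⁻¹ 0 K =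
      (A * C * x).trace + (C * Aᵀ * x).trace + 2 * (C * K).trace := by
    simp [rotQuot]
  rw [← hv]
  exact hcomp

theorem eventually_inv_mul_cancel {n : ℕ} (A : Matrix (Fin n) (Fin n) ℝ) :
    ∀ᶠ t : ℝ in 𝓝 0, (1 - (t / 2) • A)⁻¹ * (1 - (t / 2) • A) = 1 := by
  have hM : Continuous fun t : ℝ => (1 - (t / 2) • A).det := by
    apply Continuous.matrix_det
    fun_prop
  have h0 : (1 - ((0 : ℝ) / 2) • A).det ≠ 0 := by simp
  filter_upwards [hM.continuousAt.eventually_ne h0] with t ht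
  exact Matrix.nonsing_inv_mul _ (isUnit_iff_ne_zero.2 ht)

/-! ### The optimal generator -/

/-- The skew-symmetric generator that attains the second-order term in the diagonal frame. -/
def optSkew {n : ℕ} (x : Fin n → ℝ) (h : Matrix (Fin n) (Fin n) ℝ) :
    Matrix (Fin n) (Fin n) ℝ :=
  Matrix.of fun i j => h i j * (x j - x i)⁻¹

theorem optSkew_transpose {n : ℕ} (x : Fin n → ℝ) {h : Matrix (Fin n) (Fin n) ℝ}
    (hh : h.IsSymm) : (optSkew x h)ᵀ = -optSkew x h := by
  ext i j
  have h1 : (x i - x j)⁻¹ = -(x j - x i)⁻¹ := by rw [← inv_neg, neg_sub]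
  simp [optSkew, hh.apply i j, h1]

theorem commutator_diagonal_apply {n : ℕ} (A : Matrix (Fin n) (Fin n) ℝ) (y : Fin n → ℝ)
    (i j : Fin n) :
    (A * diagonal y - diagonal y * A) i j = A i j * (y j - y i) := by
  rw [Matrix.sub_apply, Matrix.mul_diagonal, Matrix.diagonal_mul]
  ring

theorem trace_commutator_diagonal_mul_diagonal {n : ℕ} (A : Matrix (Fin n) (Fin n) ℝ)
    (x y : Fin n → ℝ) :
    ((A * diagonal y - diagonal y * A) * diagonal x).trace = 0 := by
  rw [Matrix.trace]
  refine Finset.sum_eq_zero fun i _ => ?_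
  rw [Matrix.diag_apply, Matrix.mul_diagonal, commutator_diagonal_apply]
  ring

/-- For skew `A` and `C = [A, Diag y]`, the left side is `∑ (y j - y i) * (2 * A i j * h i j - A i j
^ 2 * (x j - x i))`. Setting the derivative in `A i j` to zero gives `A i j = h i j / (x j - x i)`.
-/
theorem optSkew_value {n : ℕ} (x y : Fin n → ℝ) {h : Matrix (Fin n) (Fin n) ℝ} (hh : h.IsSymm) :
    (optSkew x h * (optSkew x h * diagonal y - diagonal y * optSkew x h) * diagonal x).trace +
      ((optSkew x h * diagonal y - diagonal y * optSkew x h) * (optSkew x h)ᵀ *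
        diagonal x).trace +
      2 * ((optSkew x h * diagonal y - diagonal y * optSkew x h) * h).trace =
    2 * ∑ j, ∑ i, y j * (h i j ^ 2 * (x j - x i)⁻¹) := by
  have e1 : ∀ i j, (x i - x j)⁻¹ = -(x j - x i)⁻¹ := fun i j => by rw [← inv_neg, neg_sub]
  have t1 : (optSkew x h * (optSkew x h * diagonal y - diagonal y * optSkew x h) *
      diagonal x).trace = ∑ i, ∑ j, optSkew x h i j * (optSkew x h j i * (y i - y j)) * x i := by
    rw [Matrix.trace]
    refine Finset.sum_congr rfl fun i _ => ?_
    rw [Matrix.diag_apply, Matrix.mul_diagonal, Matrix.mul_apply, Finset.sum_mul]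
    simp only [commutator_diagonal_apply]
  have t2 : ((optSkew x h * diagonal y - diagonal y * optSkew x h) * (optSkew x h)ᵀ *
      diagonal x).trace = ∑ i, ∑ j, optSkew x h i j * (y j - y i) * optSkew x h i j * x i := by
    rw [Matrix.trace]
    refine Finset.sum_congr rfl fun i _ => ?_
    rw [Matrix.diag_apply, Matrix.mul_diagonal, Matrix.mul_apply, Finset.sum_mul]
    simp only [commutator_diagonal_apply, Matrix.transpose_apply]
  have t3 : ((optSkew x h * diagonal y - diagonal y * optSkew x h) * h).trace =
      ∑ i, ∑ j, optSkew x h i j * (y j - y i) * h j i := by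
    rw [Matrix.trace]
    refine Finset.sum_congr rfl fun i _ => ?_
    rw [Matrix.diag_apply, Matrix.mul_apply]
    simp only [commutator_diagonal_apply]
  have t4 : ∑ j, ∑ i, y j * (h i j ^ 2 * (x j - x i)⁻¹) =
      ∑ i, ∑ j, y j * (h i j ^ 2 * (x j - x i)⁻¹) := Finset.sum_comm
  have t5 : 2 * ∑ j, ∑ i, y j * (h i j ^ 2 * (x j - x i)⁻¹) =
      ∑ i, ∑ j, y j * (h i j ^ 2 * (x j - x i)⁻¹) +
        ∑ i, ∑ j, y i * (h j i ^ 2 * (x i - x j)⁻¹) := by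
    rw [two_mul]
    nth_rewrite 1 [t4]
    rfl
  have t6 : ∑ i, ∑ j, optSkew x h i j * (optSkew x h j i * (y i - y j)) * x i =
      ∑ i, ∑ j, optSkew x h j i * (optSkew x h i j * (y j - y i)) * x j := Finset.sum_comm
  rw [t1, t6, t2, t3, t5, Finset.mul_sum, ← Finset.sum_add_distrib, ← Finset.sum_add_distrib,
    ← Finset.sum_add_distrib]
  refine Finset.sum_congr rfl fun i _ => ?_
  rw [Finset.mul_sum, ← Finset.sum_add_distrib, ← Finset.sum_add_distrib,
    ← Finset.sum_add_distrib]
  refine Finset.sum_congr rfl fun j _ => ?_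
  simp only [optSkew, Matrix.of_apply]
  rw [hh.apply i j, e1 i j]
  -- Inside an eigenvalue block the convention `0⁻¹ = 0` makes both sides vanish.
  rcases eq_or_ne (x j) (x i) with hx | hx
  · simp [hx]
  · have : x j - x i ≠ 0 := sub_ne_zero.2 hx
    field_simp
    ring

/-! ### The quadratic lower bound -/

/-- Here `q` is the second-order quotient obtained by testing Fan's inequality for `X + tK` with the
rotated frame `U * V`, where `V` is the Cayley transform of `(t/2)A` and `A` is the critical
generator for `H`. -/
theorem tendsto_rotated_lower_bound {n : ℕ} {X Y : SymMat n} {U : Matrix (Fin n) (Fin n) ℝ}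
    (hX : U ∈ orthDecomp X) (hY : U ∈ orthDecomp Y) (H : SymMat n) :
    ∃ q : ℝ × SymMat n → ℝ,
      Tendsto q (𝓝[>] (0 : ℝ) ×ˢ 𝓝 H) (𝓝 (2 * ∑ j, ∑ i, eigvec Y j *
        ((Uᵀ * (H : Matrix (Fin n) (Fin n) ℝ) * U) i j ^ 2 * (eigvec X j - eigvec X i)⁻¹))) ∧
      ∀ᶠ p in 𝓝[>] (0 : ℝ) ×ˢ 𝓝 H, q p ≤
        (∑ i, eigvec Y i * eigvec (X + p.1 • p.2) i - ∑ i, eigvec Y i * eigvec X i -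
          p.1 * ((Y : Matrix (Fin n) (Fin n) ℝ) * (p.2 : Matrix (Fin n) (Fin n) ℝ)).trace) /
          (p.1 ^ 2 / 2) := by
  set x : Fin n → ℝ := fun i => eigvec X i with hx
  set y : Fin n → ℝ := fun i => eigvec Y i with hy
  set h : Matrix (Fin n) (Fin n) ℝ := Uᵀ * (H : Matrix (Fin n) (Fin n) ℝ) * U with hh
  have hsymm : h.IsSymm := by
    have : (H : Matrix (Fin n) (Fin n) ℝ).IsSymm := H.2
    rw [Matrix.IsSymm, hh, transpose_mul, transpose_mul, transpose_transpose, this.eq,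
      Matrix.mul_assoc]
  have hUt := transpose_mul_self_of_mem_orthogonalGroup hX.1
  obtain ⟨A, hA⟩ : ∃ A, A = optSkew x h := ⟨_, rfl⟩
  obtain ⟨C, hC⟩ : ∃ C, C = A * diagonal y - diagonal y * A := ⟨_, rfl⟩
  have hskew : Aᵀ = -A := by rw [hA]; exact optSkew_transpose x hsymm
  have hCx : (C * diagonal x).trace = 0 := by
    rw [hC]; exact trace_commutator_diagonal_mul_diagonal A x y
  have hval : (A * C * diagonal x).trace + (C * Aᵀ * diagonal x).trace + 2 * (C * h).trace =
      2 * ∑ j, ∑ i, y j * (h i j ^ 2 * (x j - x i)⁻¹) := by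
    rw [hC, hA]; exact optSkew_value x y hsymm
  refine ⟨fun p => rotQuot A C (diagonal x) (1 - (p.1 / 2) • A)⁻¹ p.1
    (Uᵀ * (p.2 : Matrix (Fin n) (Fin n) ℝ) * U), ?_, ?_⟩
  · have hlim := tendsto_rotQuot A C (diagonal x) h
    rw [hval, nhds_prod_eq] at hlim
    have hc : Continuous fun K : SymMat n => Uᵀ * (K : Matrix (Fin n) (Fin n) ℝ) * U :=
      (continuous_const.matrix_mul continuous_subtype_val).matrix_mul continuous_const
    have hpair : Tendsto (fun p : ℝ × SymMat n =>
        (p.1, Uᵀ * (p.2 : Matrix (Fin n) (Fin n) ℝ) * U)) (𝓝[>] (0 : ℝ) ×ˢ 𝓝 H)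
        (𝓝 0 ×ˢ 𝓝 h) :=
      (tendsto_fst.mono_right nhdsWithin_le_nhds).prodMk ((hc.tendsto H).comp tendsto_snd)
    have hfin := hlim.comp hpair
    refine Tendsto.congr (fun p => ?_) hfin
    rfl
  · have hpos : ∀ᶠ p : ℝ × SymMat n in 𝓝[>] (0 : ℝ) ×ˢ 𝓝 H, 0 < p.1 :=
      tendsto_fst.eventually self_mem_nhdsWithin
    have hinv : ∀ᶠ p : ℝ × SymMat n in 𝓝[>] (0 : ℝ) ×ˢ 𝓝 H,
        (1 - (p.1 / 2) • A)⁻¹ * (1 - (p.1 / 2) • A) = 1 :=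
      tendsto_fst.eventually (nhdsWithin_le_nhds (eventually_inv_mul_cancel A))
    filter_upwards [hpos, hinv] with p hp hR
    obtain ⟨t, K⟩ := p
    dsimp only at hp hR ⊢
    set R := (1 - (t / 2) • A)⁻¹
    rw [rotQuot_eq hp.ne' hR hCx,
      le_div_iff₀ (by positivity)]
    have hB : ((t / 2) • A)ᵀ = -((t / 2) • A) := by rw [transpose_smul, hskew, smul_neg]
    set V := R * (1 + (t / 2) • A) with hV
    have hVo : V ∈ orthogonalGroup (Fin n) ℝ := cayley_mem_orthogonalGroup hB hR
    -- The factor 2 of the Cayley formula cancels the `1/2` in `(t/2)A`.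
    have hVd : V * diagonal y * Vᵀ - diagonal y = t • (R * C * Rᵀ) := by
      rw [hV, cayley_conj_sub hB hR, hC]
      simp only [Matrix.smul_mul, Matrix.mul_smul, ← smul_sub]
      rw [← Nat.cast_smul_eq_nsmul ℝ, smul_smul]
      congr 1
      push_cast
      ring
    have h1 := trace_conj_diagonal_mul_le (mul_mem hX.1 hVo) (eigvec_antitone Y) (X + t • K)
    have h2 := trace_conj_diagonal_mul_eq hX y
    have hYU : (Y : Matrix (Fin n) (Fin n) ℝ) = U * diagonal y * Uᵀ := hY.2
    have hZ : Uᵀ * ((X + t • K : SymMat n) : Matrix (Fin n) (Fin n) ℝ) * U =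
        diagonal x + t • (Uᵀ * (K : Matrix (Fin n) (Fin n) ℝ) * U) := by
      have hXU : (X : Matrix (Fin n) (Fin n) ℝ) = U * diagonal x * Uᵀ := hX.2
      rw [Submodule.coe_add, Submodule.coe_smul, Matrix.mul_add, Matrix.add_mul, Matrix.mul_smul,
        Matrix.smul_mul, hXU]
      congr 1
      calc Uᵀ * (U * diagonal x * Uᵀ) * U = (Uᵀ * U) * diagonal x * (Uᵀ * U) := by
            simp only [Matrix.mul_assoc]
        _ = diagonal x := by rw [hUt, Matrix.one_mul, Matrix.mul_one]
    have h3 : ∀ (M Z : Matrix (Fin n) (Fin n) ℝ),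
        (U * M * Uᵀ * Z).trace = (M * (Uᵀ * Z * U)).trace := by
      intro M Z
      rw [Matrix.mul_assoc, Matrix.mul_assoc, Matrix.trace_mul_comm]
      simp only [Matrix.mul_assoc]
    have h4 : (U * V * diagonal y * (U * V)ᵀ *
        ((X + t • K : SymMat n) : Matrix (Fin n) (Fin n) ℝ)).trace =
        t * (R * C * Rᵀ * (diagonal x + t • (Uᵀ * (K : Matrix (Fin n) (Fin n) ℝ) * U))).trace +
        ((Y : Matrix (Fin n) (Fin n) ℝ) *
          ((X + t • K : SymMat n) : Matrix (Fin n) (Fin n) ℝ)).trace := by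
      have e1 : U * V * diagonal y * (U * V)ᵀ = U * (V * diagonal y * Vᵀ) * Uᵀ := by
        rw [transpose_mul]; simp only [Matrix.mul_assoc]
      rw [e1, h3, sub_eq_iff_eq_add.1 hVd, Matrix.add_mul, Matrix.trace_add, hYU, h3, hZ,
        Matrix.smul_mul, Matrix.trace_smul, smul_eq_mul]
    have h5 : ((Y : Matrix (Fin n) (Fin n) ℝ) *
        ((X + t • K : SymMat n) : Matrix (Fin n) (Fin n) ℝ)).trace =
        ∑ i, y i * eigvec X i +
          t * ((Y : Matrix (Fin n) (Fin n) ℝ) * (K : Matrix (Fin n) (Fin n) ℝ)).trace := by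
      rw [← h2, ← hYU, Submodule.coe_add, Submodule.coe_smul, Matrix.mul_add, Matrix.mul_smul,
        Matrix.trace_add, Matrix.trace_smul, smul_eq_mul]
    rw [h4, h5] at h1
    have h6 : 2 / t * (R * C * Rᵀ * (diagonal x +
        t • (Uᵀ * (K : Matrix (Fin n) (Fin n) ℝ) * U))).trace * (t ^ 2 / 2) =
        t * (R * C * Rᵀ * (diagonal x +
          t • (Uᵀ * (K : Matrix (Fin n) (Fin n) ℝ) * U))).trace := by
      field_simp
    rw [h6]
    linarith

/-! ### The block form of the quadratic term -/

/-- By uniqueness it suffices to verify the Penrose equations; `0⁻¹ = 0` is exactly the value the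
pseudoinverse takes on the kernel. -/
theorem pinv_smul_one_sub {n : ℕ} {X : SymMat n} {U : Matrix (Fin n) (Fin n) ℝ}
    (hX : U ∈ orthDecomp X) (c : ℝ) :
    pinv (c • (1 : Matrix (Fin n) (Fin n) ℝ) - (X : Matrix (Fin n) (Fin n) ℝ)) =
      U * diagonal (fun i => (c - eigvec X i)⁻¹) * Uᵀ := by
  have hUt := transpose_mul_self_of_mem_orthogonalGroup hX.1
  have hUU := mul_transpose_self_of_mem_orthogonalGroup hX.1
  have key : ∀ e f : Fin n → ℝ, (U * diagonal e * Uᵀ) * (U * diagonal f * Uᵀ) =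
      U * diagonal (fun i => e i * f i) * Uᵀ := by
    intro e f
    calc _ = U * diagonal e * (Uᵀ * U) * diagonal f * Uᵀ := by simp only [Matrix.mul_assoc]
      _ = _ := by rw [hUt, Matrix.mul_one, Matrix.mul_assoc U, diagonal_mul_diagonal]
  have symm : ∀ e : Fin n → ℝ, (U * diagonal e * Uᵀ).IsSymm := by
    intro e
    simp [Matrix.IsSymm, transpose_mul, Matrix.mul_assoc]
  have hA : c • (1 : Matrix (Fin n) (Fin n) ℝ) - (X : Matrix (Fin n) (Fin n) ℝ) =
      U * diagonal (fun i => c - eigvec X i) * Uᵀ := by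
    have hd : diagonal (fun i => c - eigvec X i) =
        c • (1 : Matrix (Fin n) (Fin n) ℝ) - eigDiag X := by
      rw [eigDiag, smul_one_eq_diagonal, diagonal_sub]
    rw [hd, Matrix.mul_sub, Matrix.sub_mul, ← hX.2, Matrix.mul_smul, Matrix.mul_one,
      Matrix.smul_mul, hUU]
  refine (pinv_spec _).unique ?_
  rw [hA]
  refine ⟨?_, ?_, ?_, ?_⟩
  · rw [key, key]
    congr 3
    funext i
    by_cases h : c - eigvec X i = 0 <;> simp [h]
  · rw [key, key]
    congr 3
    funext i
    by_cases h : c - eigvec X i = 0 <;> simp [h]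
  · rw [key]; exact symm _
  · rw [key]; exact symm _

theorem trace_prinSub_mul {n : ℕ} (Y : SymMat n) (I : Finset (Fin n))
    (N : Matrix (Fin n) (Fin n) ℝ) :
    (prinSub (eigDiag Y) I * prinSub N I).trace = ∑ j ∈ I, eigvec Y j * N j j := by
  have hd : prinSub (eigDiag Y) I = diagonal fun i : I => eigvec Y i :=
    submatrix_diagonal _ _ Subtype.val_injective
  rw [hd, ← Finset.sum_coe_sort I, Matrix.trace]
  refine Finset.sum_congr rfl fun j _ => ?_
  rw [Matrix.diag_apply, Matrix.diagonal_mul]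
  rfl

/-- Diagonalising the pseudoinverse in the frame `U` turns each block trace into a sum over its
columns `j`. The blocks partition the indices, so the total is the limit found by the Cayley
rotation. -/
theorem sum_blocks_eq {n : ℕ} {X Y : SymMat n} {U : Matrix (Fin n) (Fin n) ℝ}
    (hX : U ∈ orthDecomp X) (H : SymMat n) {r : ℕ} {μ : Fin r → ℝ} (hμ : StrictAnti μ)
    (hμX : Set.range μ = Set.range (fun i : Fin n => eigvec X i)) :
    ∑ m : Fin r, (prinSub (eigDiag Y) (eigIndex X (μ m)) *
      ((colSub U (eigIndex X (μ m)))ᵀ * (H : Matrix (Fin n) (Fin n) ℝ) *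
        pinv (μ m • (1 : Matrix (Fin n) (Fin n) ℝ) - (X : Matrix (Fin n) (Fin n) ℝ)) *
        (H : Matrix (Fin n) (Fin n) ℝ) * colSub U (eigIndex X (μ m)))).trace =
    ∑ j, ∑ i, eigvec Y j *
      ((Uᵀ * (H : Matrix (Fin n) (Fin n) ℝ) * U) i j ^ 2 * (eigvec X j - eigvec X i)⁻¹) := by
  set h : Matrix (Fin n) (Fin n) ℝ := Uᵀ * (H : Matrix (Fin n) (Fin n) ℝ) * U with hh
  have hsymm : h.IsSymm := by
    have : (H : Matrix (Fin n) (Fin n) ℝ).IsSymm := H.2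
    rw [Matrix.IsSymm, hh, transpose_mul, transpose_mul, transpose_transpose, this.eq,
      Matrix.mul_assoc]
  have hblock : ∀ m : Fin r, (prinSub (eigDiag Y) (eigIndex X (μ m)) *
      ((colSub U (eigIndex X (μ m)))ᵀ * (H : Matrix (Fin n) (Fin n) ℝ) *
        pinv (μ m • (1 : Matrix (Fin n) (Fin n) ℝ) - (X : Matrix (Fin n) (Fin n) ℝ)) *
        (H : Matrix (Fin n) (Fin n) ℝ) * colSub U (eigIndex X (μ m)))).trace =
      ∑ j, if eigvec X j = μ m then
        ∑ i, eigvec Y j * (h i j ^ 2 * (eigvec X j - eigvec X i)⁻¹) else 0 := by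
    intro m
    have e1 : (colSub U (eigIndex X (μ m)))ᵀ * (H : Matrix (Fin n) (Fin n) ℝ) *
        pinv (μ m • (1 : Matrix (Fin n) (Fin n) ℝ) - (X : Matrix (Fin n) (Fin n) ℝ)) *
        (H : Matrix (Fin n) (Fin n) ℝ) * colSub U (eigIndex X (μ m)) =
        prinSub (h * diagonal (fun i => (μ m - eigvec X i)⁻¹) * h) (eigIndex X (μ m)) := by
      rw [pinv_smul_one_sub hX]
      have e2 : h * diagonal (fun i => (μ m - eigvec X i)⁻¹) * h =
          Uᵀ * (H : Matrix (Fin n) (Fin n) ℝ) *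
            (U * diagonal (fun i => (μ m - eigvec X i)⁻¹) * Uᵀ) *
            (H : Matrix (Fin n) (Fin n) ℝ) * U := by
        rw [hh]; simp only [Matrix.mul_assoc]
      rw [e2]
      rfl
    rw [e1, trace_prinSub_mul, eigIndex, Finset.sum_filter]
    refine Finset.sum_congr rfl fun j _ => ?_
    split_ifs with hj
    · rw [Matrix.mul_apply, Finset.mul_sum]
      refine Finset.sum_congr rfl fun i _ => ?_
      rw [Matrix.mul_diagonal, hsymm.apply i j, hj]
      ring
    · rfl
  simp only [hblock]
  rw [Finset.sum_comm]
  refine Finset.sum_congr rfl fun j _ => ?_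
  obtain ⟨m, hm⟩ : eigvec X j ∈ Set.range μ := by rw [hμX]; exact ⟨j, rfl⟩
  rw [Finset.sum_eq_single m]
  · rw [if_pos hm.symm]
  · intro k _ hk
    rw [if_neg]
    rw [← hm]
    exact fun e => hk (hμ.injective e).symm
  · simp

/-! ### Second subderivatives -/

/-- An infinite `a` absorbs every real correction, so replacing the linear term `r` by `s` costs a
real summand in all cases. -/
theorem ereal_sub_sub_div_eq_add (a : EReal) (c r s : ℝ) {b : ℝ} (hb : 0 < b) :
    (a - (c : EReal) - (s : EReal)) / (b : EReal) =
      (a - (c : EReal) - (r : EReal)) / (b : EReal) + (((r - s) / b : ℝ) : EReal) := by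
  induction a with
  | bot => simp [EReal.bot_div_of_pos_ne_top (EReal.coe_pos.2 hb) (EReal.coe_ne_top b)]
  | top =>
    simp only [EReal.top_sub_coe, EReal.top_div_of_pos_ne_top (EReal.coe_pos.2 hb)
      (EReal.coe_ne_top b), EReal.top_add_coe]
  | coe a =>
    rw [← EReal.coe_sub, ← EReal.coe_sub, ← EReal.coe_sub, ← EReal.coe_div, ← EReal.coe_div,
      ← EReal.coe_add, EReal.coe_eq_coe_iff]
    ring

/-- Both quotients evaluate the same values of `g`, since `λ(X) + tw = λ(X + tK)`; they differ only
in their linear terms. -/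
theorem secondQuot_comp_eigvec {n : ℕ} {g : SymMat n → EReal}
    {θ : EuclideanSpace ℝ (Fin n) → EReal} (hgθ : ∀ Z : SymMat n, g Z = θ (eigvec Z))
    {X : SymMat n} (hbot : g X ≠ ⊥) (htop : g X ≠ ⊤) (Y K : SymMat n) {t : ℝ} (ht : 0 < t) :
    secondQuot g X Y t K =
      secondQuot θ (eigvec X) (eigvec Y) t (t⁻¹ • (eigvec (X + t • K) - eigvec X)) +
      (((∑ i, eigvec Y i * eigvec (X + t • K) i - ∑ i, eigvec Y i * eigvec X i -
          t * ((Y : Matrix (Fin n) (Fin n) ℝ) * (K : Matrix (Fin n) (Fin n) ℝ)).trace) /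
          (t ^ 2 / 2) : ℝ) : EReal) := by
  have hw : eigvec X + t • t⁻¹ • (eigvec (X + t • K) - eigvec X) = eigvec (X + t • K) := by
    rw [smul_inv_smul₀ ht.ne']; abel
  have hin : t * inner ℝ (eigvec Y) (t⁻¹ • (eigvec (X + t • K) - eigvec X)) =
      ∑ i, eigvec Y i * eigvec (X + t • K) i - ∑ i, eigvec Y i * eigvec X i := by
    rw [inner_smul_right, mul_inv_cancel_left₀ ht.ne', ← Finset.sum_sub_distrib]
    simp [PiLp.inner_apply, mul_sub, mul_comm]
  obtain ⟨c, hc⟩ : ∃ c : ℝ, g X = c := ⟨_, (EReal.coe_toReal htop hbot).symm⟩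
  rw [secondQuot, secondQuot, hw, hin, ← hgθ, ← hgθ, hc]
  exact ereal_sub_sub_div_eq_add _ _ _ _ (by positivity)

end SpectralFun

end

/-! ### Assembling the two lower bounds -/

open SpectralFun
theorem proposition5p3 {n : ℕ}
    (g : SymMat n → EReal) (θ : EuclideanSpace ℝ (Fin n) → EReal)
    (hθ : IsSymmFun θ) (hgθ : ∀ Z : SymMat n, g Z = θ (eigvec Z))
    (hlsc : LowerSemicontinuous g) (hconv : EConvex g)
    (X Y : SymMat n) (hY : Y ∈ subdiff g X)
    (r : ℕ) (μ : Fin r → ℝ) (hμ : StrictAnti μ)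
    (hμX : Set.range μ = Set.range (fun i : Fin n => eigvec X i))
    (U : Matrix (Fin n) (Fin n) ℝ) (hU : U ∈ orthDecomp X ∩ orthDecomp Y)
    (H : SymMat n) :
    HasDirDeriv eigvec X H (dirDeriv eigvec X H) ∧
      secondSubderiv θ (eigvec X) (eigvec Y) (dirDeriv eigvec X H) +
          ((2 * ∑ m : Fin r,
            (prinSub (eigDiag Y) (eigIndex X (μ m)) *
              ((colSub U (eigIndex X (μ m))).transpose * (H : Matrix (Fin n) (Fin n) ℝ) *
                pinv (μ m • (1 : Matrix (Fin n) (Fin n) ℝ) - (X : Matrix (Fin n) (Fin n) ℝ)) *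
                (H : Matrix (Fin n) (Fin n) ℝ) * colSub U (eigIndex X (μ m)))).trace : ℝ) :
            EReal)
        ≤ secondSubderiv g X Y H := by
  obtain ⟨l, hl⟩ := exists_tendsto_eigvec X H
  have hdir : HasDirDeriv eigvec X H l :=
    hl.comp (tendsto_id.prodMk (tendsto_const_nhds (x := H)))
  have hlim : dirDeriv eigvec X H = l := Tendsto.limUnder_eq hdir
  rw [hlim, sum_blocks_eq hU.1 H hμ hμX]
  refine ⟨hdir, ?_⟩
  obtain ⟨q, hq, hle⟩ := tendsto_rotated_lower_bound hU.1 hU.2 H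
  have hpos : ∀ᶠ p : ℝ × SymMat n in 𝓝[>] (0 : ℝ) ×ˢ 𝓝 H, 0 < p.1 :=
    tendsto_fst.eventually self_mem_nhdsWithin
  have hq' : Tendsto (fun p => (q p : EReal)) (𝓝[>] (0 : ℝ) ×ˢ 𝓝 H) _ :=
    (continuous_coe_real_ereal.tendsto _).comp hq
  -- Writing the quadratic term as a lower limit allows superadditivity of `liminf` to be applied.
  rw [← hq'.liminf_eq]
  -- The pairs `(t, w)` tend to `(0⁺, λ'(X; H))`, so a lower limit along them is at least the full
  -- one.
  have hθl : secondSubderiv θ (eigvec X) (eigvec Y) l ≤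
      liminf ((fun p : ℝ × EuclideanSpace ℝ (Fin n) =>
        secondQuot θ (eigvec X) (eigvec Y) p.1 p.2) ∘ fun p : ℝ × SymMat n =>
          (p.1, p.1⁻¹ • (eigvec (X + p.1 • p.2) - eigvec X))) (𝓝[>] (0 : ℝ) ×ˢ 𝓝 H) :=
    (tendsto_fst.prodMk hl).liminf_le_liminf_comp
  refine (add_le_add_left hθl _).trans (EReal.le_liminf_add.trans (liminf_le_liminf ?_))
  filter_upwards [hpos, hle] with p hp hqp
  rw [secondQuot_comp_eigvec hgθ hY.1 hY.2.1 Y p.2 hp]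
  exact add_le_add le_rfl (EReal.coe_le_coe_iff.2 hqp)
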